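/- Recall that a subgroup $H$ of a group $K$ is a retract of $K$ if there is a homomorphism $\rho\colon K\to H$ which restricts to the identity map on $H$. A subgroup $H$ of a group $G$ is a virtual retract of $G$ if there is a subgroup $K\le G$ of finite index such that $H\subseteq K$ and $H$ is a retract of $K$. A group has property (VRC) if each of its cyclic subgroups is a virtual retract of it. Let $\Gamma$ be a simplicial graph, finite or infinite, with vertex set $V\Gamma$ and edge set $E\Gamma$, and let $\mathfrak{G}=\{G_v\mid v\in V\Gamma\}$ be a collection of groups. The graph product $\Gamma\mathfrak{G}$ is the quotient of the free product $\ast_{v\in V\Gamma}G_v$ by the relations $[g_u,g_v]=1$ for all $g_u\in G_u$, $g_v\in G_v$ whenever $(u,v)\in E\Gamma$. **Theorem.** If each of the groups $G_v$, $v\in V\Gamma$, has property (VRC), then the graph product $\Gamma\mathfrak{G}$ has property (VRC). (In particular, this holds when $\Gamma$ is finite.) -/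

import Mathlib

namespace VirtualRetraction

/-- A subgroup `H` of a group `K` is a retract of `K` if there is a homomorphism `K → H` which
restricts to the identity map on `H`. -/
def IsRetract {K : Type*} [Group K] (H : Subgroup K) : Prop :=
  ∃ ρ : K →* H, ∀ h : H, ρ (h : K) = h

/-- A subgroup `H` of a group `G` is a virtual retract of `G` if there is a finite index subgroup
`K` of `G` which contains `H` and such that `H` is a retract of `K`. -/
def IsVirtualRetract {G : Type*} [Group G] (H : Subgroup G) : Prop :=
  ∃ K : Subgroup G, K.FiniteIndex ∧ H ≤ K ∧ IsRetract (H.subgroupOf K)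

/-- Property (VRC): every cyclic subgroup is a virtual retract. -/
def HasVRC (G : Type*) [Group G] : Prop :=
  ∀ H : Subgroup G, IsCyclic H → IsVirtualRetract H

/-- The defining relators of a graph product, as elements of the free product of the vertex groups:
the commutators of elements of the vertex groups at two adjacent vertices. -/
def graphProductRelators {V : Type*} (Γ : SimpleGraph V) (𝔊 : V → Type*) [∀ v, Group (𝔊 v)] :
    Set (Monoid.CoprodI 𝔊) :=
  {w | ∃ u v : V, Γ.Adj u v ∧ ∃ (a : 𝔊 u) (b : 𝔊 v),
    w = Monoid.CoprodI.of a * Monoid.CoprodI.of b *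
      (Monoid.CoprodI.of a)⁻¹ * (Monoid.CoprodI.of b)⁻¹}

/-- The graph product of the family of groups `𝔊` over the simplicial graph `Γ`: the quotient of the
free product of the vertex groups by the normal closure of the relators. -/
def GraphProduct {V : Type*} (Γ : SimpleGraph V) (𝔊 : V → Type*) [∀ v, Group (𝔊 v)] : Type _ :=
  Monoid.CoprodI 𝔊 ⧸ Subgroup.normalClosure (graphProductRelators Γ 𝔊)

instance {V : Type*} (Γ : SimpleGraph V) (𝔊 : V → Type*) [∀ v, Group (𝔊 v)] :
    Group (GraphProduct Γ 𝔊) :=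
  inferInstanceAs
    (Group (Monoid.CoprodI 𝔊 ⧸ Subgroup.normalClosure (graphProductRelators Γ 𝔊)))

end VirtualRetraction

/-! An element of the graph product involves finitely many vertices, and killing the other vertex
groups is an endomorphism that fixes it, so finite vertex sets suffice. Vertices are added one at a
time. Let `A` be the graph product over `S`, and `B ≤ A` the subgroup over the neighbours of a new
vertex `v`. Killing `𝔊 v` leaves as kernel a free product of copies of `𝔊 v` indexed by `A ⧸ B`, so
the graph product over `insert v S` embeds in the semidirect product of this free product with `A`
(`ofVertexExtension_toVertexExtension`).

That semidirect product has (VRC) by `HasVRC.semidirectProduct`. By `HasVRC.of_ker`, which rests on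
a transfer argument, only elements of the free product matter; these are conjugated to cyclically
reduced words. A single letter is detected by folding all factors onto `𝔊 v`. For a longer word, `B`
is the fixed subgroup of an endomorphism of `A`, hence separable, so suitable finite quotients of
`A` and `𝔊 v` keep the word cyclically reduced. In a free product of copies of a finite group `Q`,
an explicit periodic action on `ℤ × Q` in which the word translates a point yields the retraction.
-/

namespace VirtualRetraction

open Subgroup Monoid

/-! ### Cyclic virtual retracts and their transport along homomorphisms. -/

section Cyclic

variable {G P : Type*} [Group G] [Group P]

theorem finiteIndex_map_subtype {K : Subgroup G} [K.FiniteIndex] (D : Subgroup K)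
    [D.FiniteIndex] : (D.map K.subtype).FiniteIndex :=
  ⟨by
    rw [index_map_subtype]
    exact mul_ne_zero FiniteIndex.index_ne_zero FiniteIndex.index_ne_zero⟩

instance finiteIndex_comap (f : G →* P) (K : Subgroup P) [K.FiniteIndex] :
    (K.comap f).FiniteIndex :=
  ⟨by
    rw [index_comap]
    exact FiniteIndex.index_ne_zero (H := K.subgroupOf f.range)⟩

theorem isVirtualRetract_zpowers_of_retraction {g : G} (K : Subgroup G) [hK : K.FiniteIndex]
    (hg : g ∈ K) (σ : K →* G) (hσ : ∀ k, σ k ∈ zpowers g) (hσg : σ ⟨g, hg⟩ = g) :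
    IsVirtualRetract (zpowers g) := by
  have hle : zpowers g ≤ K := by simpa using hg
  refine ⟨K, hK, hle, ?_⟩
  refine ⟨(σ.codRestrict K fun k => hle (hσ k)).codRestrict _ fun k => ?_, ?_⟩
  · rw [mem_subgroupOf]; exact hσ k
  · rintro ⟨⟨h, hK⟩, hh⟩
    rw [mem_subgroupOf] at hh
    obtain ⟨n, rfl⟩ := mem_zpowers_iff.1 hh
    have : (⟨g ^ n, hK⟩ : K) = ⟨g, hg⟩ ^ n := rfl
    apply Subtype.ext
    apply Subtype.ext
    simp [this, hσg]

theorem IsVirtualRetract.exists_retraction {g : G} (h : IsVirtualRetract (zpowers g)) :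
    ∃ K : Subgroup G, K.FiniteIndex ∧ ∃ hg : g ∈ K, ∃ σ : K →* zpowers g,
      σ ⟨g, hg⟩ = ⟨g, mem_zpowers g⟩ := by
  obtain ⟨K, hK, hle, ρ, hρ⟩ := h
  refine ⟨K, hK, hle (mem_zpowers g), (subgroupOfEquivOfLe hle).toMonoidHom.comp ρ, ?_⟩
  have := hρ ⟨⟨g, hle (mem_zpowers g)⟩, mem_zpowers g⟩
  simp only [MonoidHom.comp_apply]
  rw [this]
  rfl

/-- Cyclic virtual retracts may be detected by a homomorphism from a finite index subgroup. -/
theorem isVirtualRetract_zpowers_of_hom (K : Subgroup G) [K.FiniteIndex] (φ : K →* P) (g : K)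
    (hinj : ∀ n : ℤ, φ g ^ n = 1 → g ^ n = 1) (h : IsVirtualRetract (zpowers (φ g))) :
    IsVirtualRetract (zpowers (g : G)) := by
  obtain ⟨K', hK', hg', σ, hσ⟩ := h.exists_retraction
  -- By `hinj`, `φ` identifies `⟨g⟩` with `⟨φ g⟩`; the inverse identification pulls `σ` back to the
  -- preimage of `K'`.
  let f : zpowers g →* zpowers (φ g) :=
    (φ.comp (zpowers g).subtype).codRestrict _ (by
      rintro ⟨x, hx⟩
      obtain ⟨n, rfl⟩ := mem_zpowers_iff.1 hx
      exact mem_zpowers_iff.2 ⟨n, by simp⟩)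
  have hf : Function.Bijective f := by
    constructor
    · rw [injective_iff_map_eq_one]
      rintro ⟨x, hx⟩ h1
      obtain ⟨n, rfl⟩ := mem_zpowers_iff.1 hx
      have := congrArg Subtype.val h1
      exact Subtype.ext (hinj n (by simpa [f] using this))
    · rintro ⟨x, hx⟩
      obtain ⟨n, rfl⟩ := mem_zpowers_iff.1 hx
      exact ⟨⟨g ^ n, mem_zpowers_iff.2 ⟨n, rfl⟩⟩, Subtype.ext (by simp [f])⟩
  let e := MulEquiv.ofBijective f hf
  have hfi : ((K'.comap φ).map K.subtype).FiniteIndex := finiteIndex_map_subtype _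
  have hle : (K'.comap φ).map K.subtype ≤ K := map_subtype_le _
  let j : ((K'.comap φ).map K.subtype : Subgroup G) →* K' :=
    (φ.comp (inclusion hle)).codRestrict _ (by
      rintro ⟨_, ⟨x, hx, rfl⟩⟩
      exact hx)
  refine isVirtualRetract_zpowers_of_retraction ((K'.comap φ).map K.subtype)
    ⟨g, hg', rfl⟩ (K.subtype.comp ((zpowers g).subtype.comp
      (e.symm.toMonoidHom.comp (σ.comp j)))) ?_ ?_
  · intro k
    obtain ⟨n, hn⟩ := mem_zpowers_iff.1 (e.symm (σ (j k))).2
    refine mem_zpowers_iff.2 ⟨n, ?_⟩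
    have := congrArg Subtype.val hn
    simpa using this
  · have h1 : j ⟨g, ⟨g, hg', rfl⟩⟩ = ⟨φ g, hg'⟩ := rfl
    have h2 : e.symm ⟨φ g, mem_zpowers _⟩ = ⟨g, mem_zpowers g⟩ := by
      rw [MulEquiv.symm_apply_eq]; rfl
    simp only [MonoidHom.comp_apply, h1, hσ]
    change ((e.symm ⟨φ g, mem_zpowers _⟩ : zpowers g) : K).1 = g
    rw [h2]

theorem isVirtualRetract_zpowers_of_map (φ : G →* P) (g : G)
    (hinj : ∀ n : ℤ, φ g ^ n = 1 → g ^ n = 1) (h : IsVirtualRetract (zpowers (φ g))) :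
    IsVirtualRetract (zpowers g) :=
  isVirtualRetract_zpowers_of_hom ⊤ (φ.comp (⊤ : Subgroup G).subtype) ⟨g, mem_top g⟩
    (fun n hn => Subtype.ext (hinj n hn)) h

theorem HasVRC.zpowers (h : HasVRC G) (g : G) : IsVirtualRetract (zpowers g) :=
  h _ inferInstance

theorem hasVRC_of_zpowers (h : ∀ g : G, IsVirtualRetract (zpowers g)) : HasVRC G := by
  intro H hH
  obtain ⟨g, rfl⟩ := H.isCyclic_iff_exists_zpowers_eq_top.1 hH
  exact h g

theorem HasVRC.of_injective (φ : G →* P) (hφ : Function.Injective φ) (h : HasVRC P) :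
    HasVRC G :=
  hasVRC_of_zpowers fun g => isVirtualRetract_zpowers_of_map φ g
    (fun n hn => hφ (by simpa using hn)) (h.zpowers _)

theorem isVirtualRetract_of_finiteIndex (H : Subgroup G) [hH : H.FiniteIndex] :
    IsVirtualRetract H := by
  refine ⟨H, hH, le_rfl, (MonoidHom.id H).codRestrict _ fun k => ?_, fun h => rfl⟩
  rw [mem_subgroupOf]; exact k.2

theorem isVirtualRetract_conj {g : G} (c : G) (h : IsVirtualRetract (zpowers (c * g * c⁻¹))) :
    IsVirtualRetract (zpowers g) :=
  isVirtualRetract_zpowers_of_map (MulAut.conj c).toMonoidHom g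
    (fun n hn => (MulAut.conj c).injective (by simpa using hn)) (by simpa using h)

/-- A nontrivial subgroup of `ℤ` has finite index, so it is a virtual retract of `ℤ`, and `f` is
injective on `⟨g⟩`. -/
theorem isVirtualRetract_zpowers_of_int (K : Subgroup G) [K.FiniteIndex]
    (f : K →* Multiplicative ℤ) (g : K) (hg : f g ≠ 1) : IsVirtualRetract (zpowers (g : G)) := by
  refine isVirtualRetract_zpowers_of_hom K f g (fun n hn => ?_) ?_
  · have h0 : n * (f g).toAdd = 0 := by simpa using congrArg Multiplicative.toAdd hn
    rcases mul_eq_zero.1 h0 with h0 | h0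
    · simp [h0]
    · exact absurd (Multiplicative.toAdd.injective (by simpa using h0)) hg
  · have : (zpowers (f g)).FiniteIndex := by
      constructor
      have h1 : (zpowers (f g)).index = (AddSubgroup.zmultiples (f g).toAdd).index := rfl
      rw [h1, Int.index_zmultiples]
      simpa using hg
    exact isVirtualRetract_of_finiteIndex _

/-- A nontrivial generator of a cyclic virtual retract is missed by some finite index subgroup. -/
theorem IsVirtualRetract.exists_finiteIndex_notMem {g : G} (h : IsVirtualRetract (zpowers g))
    (hg : g ≠ 1) : ∃ K : Subgroup G, K.FiniteIndex ∧ K.Normal ∧ g ∉ K := by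
  suffices H : ∃ K : Subgroup G, K.FiniteIndex ∧ g ∉ K by
    obtain ⟨K, hK, hgK⟩ := H
    exact ⟨K.normalCore, inferInstance, inferInstance, fun h => hgK (K.normalCore_le h)⟩
  obtain ⟨K, hK, hgK, σ, hσ⟩ := h.exists_retraction
  -- Inside `⟨g⟩` the trivial subgroup serves if `g` has finite order, and the subgroup of squares
  -- otherwise.
  obtain ⟨D, hD, hgD⟩ : ∃ D : Subgroup (zpowers g), D.FiniteIndex ∧
      (⟨g, mem_zpowers g⟩ : zpowers g) ∉ D := by
    by_cases hfin : IsOfFinOrder g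
    · have : Finite (zpowers g) := finite_zpowers.2 hfin
      exact ⟨⊥, inferInstance, fun h => hg (congrArg Subtype.val (mem_bot.1 h))⟩
    · refine ⟨zpowers (⟨g, mem_zpowers g⟩ ^ 2), ?_, ?_⟩
      · let F : Bool → zpowers g ⧸ zpowers ((⟨g, mem_zpowers g⟩ : zpowers g) ^ 2) :=
          fun b => if b then ((⟨g, mem_zpowers g⟩ : zpowers g) : _ ⧸ _) else 1
        have hF : Function.Surjective F := by
          intro q
          obtain ⟨⟨x, hx⟩, rfl⟩ := QuotientGroup.mk_surjective q
          obtain ⟨n, rfl⟩ := mem_zpowers_iff.1 hx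
          rcases Int.even_or_odd' n with ⟨m, rfl | rfl⟩
          · refine ⟨false, ?_⟩
            simp only [F, Bool.false_eq_true, if_false]
            rw [eq_comm, QuotientGroup.eq_one_iff]
            exact mem_zpowers_iff.2 ⟨m, Subtype.ext (by simp [zpow_mul])⟩
          · refine ⟨true, ?_⟩
            simp only [F, if_true]
            rw [QuotientGroup.eq]
            refine mem_zpowers_iff.2 ⟨m, Subtype.ext ?_⟩
            simp [zpow_add, zpow_mul]
            group
        have := Finite.of_surjective F hF
        exact finiteIndex_of_finite_quotient
      · intro h
        obtain ⟨n, hn⟩ := mem_zpowers_iff.1 h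
        have h1 : g ^ (2 * n) = g ^ (1 : ℤ) := by
          have := congrArg Subtype.val hn
          simpa [zpow_mul] using this
        have := injective_zpow_iff_not_isOfFinOrder.2 hfin h1
        omega
  have hfi : ((D.comap σ).map K.subtype).FiniteIndex := finiteIndex_map_subtype _
  refine ⟨_, hfi, ?_⟩
  rintro ⟨⟨x, hx⟩, hxD, h⟩
  obtain rfl : x = g := h
  exact hgD (by rw [← hσ]; exact hxD)

/-- Intersecting the subgroups that miss the finitely many nontrivial powers of `g` gives a finite
quotient in which `⟨g⟩` embeds; in a finite group every subgroup is a virtual retract. -/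
theorem isVirtualRetract_zpowers_of_isOfFinOrder {g : G} (hg : IsOfFinOrder g)
    (h : ∀ n : ℕ, g ^ n ≠ 1 → ∃ K : Subgroup G, K.FiniteIndex ∧ K.Normal ∧ g ^ n ∉ K) :
    IsVirtualRetract (zpowers g) := by
  have h' : ∀ n : ℕ, ∃ K : Subgroup G, K.FiniteIndex ∧ K.Normal ∧ (g ^ n ≠ 1 → g ^ n ∉ K) := by
    intro n
    by_cases hn : g ^ n = 1
    · exact ⟨⊤, inferInstance, inferInstance, fun h => absurd hn h⟩
    · obtain ⟨K, h1, h2, h3⟩ := h n hn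
      exact ⟨K, h1, h2, fun _ => h3⟩
  choose K hK hKn hgK using h'
  let N : Subgroup G := ⨅ i : Fin (orderOf g), K i
  have hN : N.FiniteIndex := finiteIndex_iInf fun i => hK i
  have hNn : N.Normal := normal_iInf_normal fun i => hKn i
  refine isVirtualRetract_zpowers_of_map (QuotientGroup.mk' N) g (fun n hn => ?_) ?_
  · rw [← map_zpow, QuotientGroup.mk'_apply, QuotientGroup.eq_one_iff] at hn
    by_contra hne
    have hpos : (0 : ℤ) < orderOf g := by exact_mod_cast hg.orderOf_pos
    obtain ⟨i, hi⟩ := Int.eq_ofNat_of_zero_le (Int.emod_nonneg n hpos.ne')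
    have hlt : i < orderOf g := by
      have := Int.emod_lt_of_pos n hpos
      omega
    have heq : g ^ i = g ^ n := by
      rw [← zpow_natCast, ← zpow_mod_orderOf g n, hi]
    have := (mem_iInf.1 hn) ⟨i, hlt⟩
    rw [← heq] at this hne
    exact hgK i hne this
  · have : Finite (G ⧸ N) := finite_quotient_of_finiteIndex
    exact isVirtualRetract_of_finiteIndex _

/-- Passing from a power of an element of infinite order to the element itself: the retraction is
averaged by a transfer. -/
theorem isVirtualRetract_zpowers_of_pow {g : G} (hg : ¬ IsOfFinOrder g) (m : ℕ)
    (hm : m ≠ 0) (h : IsVirtualRetract (zpowers (g ^ m))) : IsVirtualRetract (zpowers g) := by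
  obtain ⟨K, hK, hgK, σ, hσ⟩ := h.exists_retraction
  have hgm : Function.Injective (fun n : ℤ => (g ^ m) ^ n) := by
    rw [injective_zpow_iff_not_isOfFinOrder]
    intro h
    exact hg (h.of_pow hm)
  let e : Multiplicative ℤ ≃* zpowers (g ^ m) :=
    MulEquiv.ofBijective ((zpowersHom G (g ^ m)).codRestrict (zpowers (g ^ m))
      fun n => mem_zpowers_iff.2 ⟨n.toAdd, rfl⟩)
      ⟨fun a b hab => hgm (congrArg Subtype.val hab), by
        rintro ⟨x, hx⟩
        obtain ⟨n, rfl⟩ := mem_zpowers_iff.1 hx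
        exact ⟨Multiplicative.ofAdd n, rfl⟩⟩
  let f : K →* Multiplicative ℤ := e.symm.toMonoidHom.comp σ
  have hf : f ⟨g ^ m, hgK⟩ = Multiplicative.ofAdd 1 := by
    simp only [f, MonoidHom.comp_apply, hσ]
    change e.symm _ = _
    rw [MulEquiv.symm_apply_eq]
    exact Subtype.ext (zpow_one _).symm
  let N := K.normalCore
  -- `g` itself need not lie in `K`. In `L = ⟨g⟩N`, any conjugate of a power of `g` lying in `N` is
  -- already an `N`-conjugate of that power, so a homomorphism from `N` to `ℤ` takes the same value
  -- on both.
  let L : Subgroup G := zpowers g ⊔ N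
  have hgL : g ∈ L := mem_sup_left (mem_zpowers g)
  have hL : L.FiniteIndex := finiteIndex_of_le (le_sup_right : N ≤ L)
  let H : Subgroup L := N.subgroupOf L
  have hHK : ∀ x : H, ((x : L) : G) ∈ K := fun x => K.normalCore_le x.2
  let ϕ : H →* Multiplicative ℤ :=
    f.comp ((L.subtype.comp H.subtype).codRestrict K hHK)
  have hpos : ∀ n : ℕ, 0 < n → ∀ hn : (⟨g, hgL⟩ : L) ^ n ∈ H, 0 < (ϕ ⟨_, hn⟩).toAdd := by
    intro n hn hmem
    -- Since `f` sends `g ^ m` to `1`, the value `ϕ (g ^ n)` is `n / m`, which is positive.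
    have h1 : ϕ ⟨_, hmem⟩ ^ m = Multiplicative.ofAdd (n : ℤ) := by
      have : (⟨((⟨g, hgL⟩ : L) ^ n : L), hHK ⟨_, hmem⟩⟩ : K) ^ m = ⟨g ^ m, hgK⟩ ^ n :=
        Subtype.ext (by simp [← pow_mul, mul_comm])
      change f _ ^ m = _
      rw [← map_pow]
      refine (congrArg f this).trans ?_
      rw [map_pow, hf, ← ofAdd_nsmul]
      simp
    have h2 : (m : ℤ) * (ϕ ⟨_, hmem⟩).toAdd = n := by
      simpa using congrArg Multiplicative.toAdd h1
    by_contra hneg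
    push Not at hneg
    have : (m : ℤ) * (ϕ ⟨_, hmem⟩).toAdd ≤ 0 :=
      mul_nonpos_of_nonneg_of_nonpos (by positivity) hneg
    omega
  have hHn : H.Normal := inferInstance
  have hHf : H.FiniteIndex := inferInstance
  have hφconj : ∀ (n : ℕ) (q : L) (hq : q⁻¹ * (⟨g, hgL⟩ : L) ^ n * q ∈ H), 0 < n →
      0 < (ϕ ⟨_, hq⟩).toAdd := by
    intro n q hq hn
    have hmem : (⟨g, hgL⟩ : L) ^ n ∈ H := by
      have := hHn.conj_mem _ hq q
      simpa [mul_assoc] using this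
    obtain ⟨y, hy, z, hz, hyz⟩ := mem_sup_of_normal_right.1 q.2
    obtain ⟨i, rfl⟩ := mem_zpowers_iff.1 hy
    have hzL : z ∈ L := mem_sup_right hz
    have hq' : q = (⟨g, hgL⟩ : L) ^ i * ⟨z, hzL⟩ := Subtype.ext (by simp [hyz])
    have heq : (⟨_, hq⟩ : H) = (⟨⟨z, hzL⟩, hz⟩ : H)⁻¹ * ⟨_, hmem⟩ * ⟨⟨z, hzL⟩, hz⟩ := by
      apply Subtype.ext
      simp only [hq', mul_inv_rev]
      push_cast
      group
    have hϕ : ϕ ⟨_, hq⟩ = ϕ ⟨_, hmem⟩ := by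
      rw [heq, ϕ.map_mul, ϕ.map_mul, ϕ.map_inv, mul_comm, mul_inv_cancel_left]
    rw [hϕ]
    exact hpos n hn hmem
  classical
  have : Fintype (Quotient (MulAction.orbitRel (zpowers (⟨g, hgL⟩ : L)) (L ⧸ H))) :=
    Fintype.ofFinite _
  refine isVirtualRetract_zpowers_of_int L (MonoidHom.transfer ϕ) ⟨g, hgL⟩ ?_
  -- The transfer of `g` is a product, over the `⟨g⟩`-orbits on `L ⧸ H`, of `ϕ` at conjugates of
  -- positive powers of `g`. All terms are positive in `ℤ`, so they cannot cancel.
  rw [MonoidHom.transfer_eq_prod_quotient_orbitRel_zpowers_quot]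
  intro h1
  have h2 := congrArg Multiplicative.toAdd h1
  rw [toAdd_prod, toAdd_one] at h2
  refine absurd h2 (ne_of_gt ?_)
  refine Finset.sum_pos (fun q _ => hφconj _ _ _ ?_) ⟨Quotient.mk'' (1 : L ⧸ H), Finset.mem_univ _⟩
  exact Nat.pos_of_ne_zero (NeZero.ne _)

/-- (VRC) lifts along a homomorphism all of whose kernel elements generate virtual retracts. -/
theorem HasVRC.of_ker (p : G →* P) (hP : HasVRC P)
    (hker : ∀ g ∈ p.ker, IsVirtualRetract (Subgroup.zpowers g)) : HasVRC G := by
  refine hasVRC_of_zpowers fun g => ?_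
  -- If `p g` has infinite order, `p` is injective on `⟨g⟩`. Otherwise a power of `g` lies in the
  -- kernel, which settles infinite `⟨g⟩`; for finite `⟨g⟩`, each nontrivial power is separated from
  -- `1` either in `P` or as a kernel element.
  by_cases ha : IsOfFinOrder (p g)
  · obtain ⟨m, hm, hpm⟩ := isOfFinOrder_iff_pow_eq_one.1 ha
    by_cases hg : IsOfFinOrder g
    · refine isVirtualRetract_zpowers_of_isOfFinOrder hg fun n hn => ?_
      by_cases hpn : p (g ^ n) = 1
      · exact (hker _ hpn).exists_finiteIndex_notMem hn
      · obtain ⟨K, hK, hKn, hgK⟩ := (hP.zpowers _).exists_finiteIndex_notMem hpn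
        exact ⟨K.comap p, inferInstance, inferInstance, hgK⟩
    · exact isVirtualRetract_zpowers_of_pow hg m hm.ne' (hker _ (by simpa using hpm))
  · refine isVirtualRetract_zpowers_of_map p g (fun n hn => ?_) (hP.zpowers _)
    have := (injective_zpow_iff_not_isOfFinOrder.2 ha) (hn.trans (zpow_zero (p g)).symm)
    simp [this]

end Cyclic


/-! ### Cyclically reduced words in free products of copies of one group. -/

section FreeProduct

/-- An element is a virtual retract of infinite order if, in an action on `ℤ × Q` commuting with a
translation of the first coordinate, it translates some point. -/
theorem isVirtualRetract_zpowers_of_periodic_action {G Q : Type*} [Group G] [Finite Q]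
    (a : G →* Equiv.Perm (ℤ × Q)) {k : ℤ} (hk : 0 < k)
    (ha : ∀ (g : G) (m j : ℤ) (q : Q),
      a g (j + m * k, q) = ((a g (j, q)).1 + m * k, (a g (j, q)).2))
    (j : ℤ) (q : Q) (g : G) (m : ℤ) (hm : m ≠ 0) (hg : a g (j, q) = (j + m * k, q)) :
    IsVirtualRetract (zpowers g) ∧ ∀ n : ℤ, g ^ n = 1 → n = 0 := by
  -- The stabilizer of the class of `(j, q)` modulo translation by `k`. There are finitely many
  -- classes, so the index is finite, and the amount of translation is a homomorphism to `ℤ`.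
  let K : Subgroup G :=
    { carrier := {g | ∃ m : ℤ, a g (j, q) = (j + m * k, q)}
      one_mem' := ⟨0, by simp⟩
      mul_mem' := by
        rintro g h ⟨m, hm⟩ ⟨n, hn⟩
        refine ⟨m + n, ?_⟩
        rw [map_mul, Equiv.Perm.mul_apply, hn, ha, hm]
        ext <;> simp
        ring
      inv_mem' := by
        rintro g ⟨m, hm⟩
        refine ⟨-m, ?_⟩
        rw [map_inv, Equiv.Perm.inv_eq_iff_eq, ha, hm]
        ext <;> simp }
  choose f hf using fun x : K => x.2
  have hinj : ∀ m n : ℤ, (j + m * k, q) = (j + n * k, q) → m = n := by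
    intro m n h
    have h1 : j + m * k = j + n * k := congrArg Prod.fst h
    exact mul_right_cancel₀ hk.ne' (add_left_cancel h1)
  let F : K →* Multiplicative ℤ := MonoidHom.mk' (fun x => Multiplicative.ofAdd (f x)) (by
    intro x y
    rw [← ofAdd_add]
    congr 1
    apply hinj
    rw [← hf (x * y), coe_mul, map_mul, Equiv.Perm.mul_apply, hf y, ha, hf x]
    ext <;> simp
    ring)
  have hKf : K.FiniteIndex := by
    have : NeZero k.toNat := ⟨by omega⟩
    let c : G ⧸ K → Fin k.toNat × Q := fun x =>
      (⟨((a x.out (j, q)).1 % k).toNat, by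
        have h1 := Int.emod_lt_of_pos (a x.out (j, q)).1 hk
        omega⟩, (a x.out (j, q)).2)
    have hc : Function.Injective c := by
      intro x y hxy
      have h1 : ((a x.out (j, q)).1 % k).toNat = ((a y.out (j, q)).1 % k).toNat :=
        congrArg (fun z : Fin k.toNat × Q => (z.1 : ℕ)) hxy
      have h2 : (a x.out (j, q)).2 = (a y.out (j, q)).2 := 
        congrArg (fun z : Fin k.toNat × Q => z.2) hxy
      have h3 : (a x.out (j, q)).1 % k = (a y.out (j, q)).1 % k := by
        have := Int.emod_nonneg (a x.out (j, q)).1 hk.ne'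
        have := Int.emod_nonneg (a y.out (j, q)).1 hk.ne'
        omega
      obtain ⟨m, hm⟩ := Int.dvd_of_emod_eq_zero (Int.emod_eq_emod_iff_emod_sub_eq_zero.1 h3.symm)
      rw [← QuotientGroup.out_eq' x, ← QuotientGroup.out_eq' y, QuotientGroup.eq]
      refine ⟨m, ?_⟩
      rw [map_mul, map_inv, Equiv.Perm.mul_apply, Equiv.Perm.inv_eq_iff_eq, ha]
      ext
      · simp only
        linarith
      · exact h2.symm
    have := Finite.of_injective c hc
    exact finiteIndex_of_finite_quotient
  have hgK : g ∈ K := ⟨m, hg⟩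
  have hFg : F ⟨g, hgK⟩ = Multiplicative.ofAdd m := by
    change Multiplicative.ofAdd (f _) = _
    congr 1
    apply hinj
    rw [← hf, hg]
  refine ⟨isVirtualRetract_zpowers_of_int K F ⟨g, hgK⟩ ?_, fun n hn => ?_⟩
  · rw [hFg]
    simpa using hm
  · have h1 : (⟨g, hgK⟩ : K) ^ n = 1 := Subtype.ext hn
    have h2 := congrArg F h1
    rw [map_zpow, hFg, map_one] at h2
    have h3 : n * m = 0 := by simpa using congrArg Multiplicative.toAdd h2
    exact (mul_eq_zero.1 h3).resolve_right hm

variable {Y Y' Y'' H Q R : Type*} [Group H] [Group Q] [Group R]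

section Glue

variable (x : ℤ → Y) (s : ℤ → Q)

open Classical in
/-- The identification, in the copies of `Q` indexed by `ℤ`, of the element `s j` of the `j`-th copy
with the identity of the previous copy, for those `j` with `x j = y`, as a partial swap. -/
noncomputable def glue (y : Y) (p : ℤ × Q) : ℤ × Q :=
  if x p.1 = y ∧ p.2 = s p.1 then (p.1 - 1, 1)
  else if x (p.1 + 1) = y ∧ p.2 = 1 then (p.1 + 1, s (p.1 + 1)) else p

variable {x s}

/-- The map exchanges `(j, s j)` with `(j - 1, 1)` whenever `x j = y`. By `hx`, no two consecutive
`j` qualify, so these exchanges are disjoint. -/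
theorem glue_involutive (hx : ∀ j, x j ≠ x (j + 1)) (y : Y) :
    Function.Involutive (glue x s y) := by
  rintro ⟨j, q⟩
  by_cases h1 : x j = y ∧ q = s j
  · have h3 : x (j - 1) ≠ y := by
      have := hx (j - 1)
      rw [sub_add_cancel, h1.1] at this
      exact this
    simp [glue, h1, h3]
  · by_cases h2 : x (j + 1) = y ∧ q = 1
    · have h3 : x j ≠ y := by
        rw [← h2.1]; exact hx j
      simp [glue, h2, h3]
    · simp [glue, h1, h2]

theorem glue_add_period {k : ℤ} (hxk : Function.Periodic x k) (hsk : Function.Periodic s k) (y : Y)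
    (j : ℤ) (q : Q) :
    glue x s y (j + k, q) = ((glue x s y (j, q)).1 + k, (glue x s y (j, q)).2) := by
  have h1 : j + k + 1 = j + 1 + k := by ring
  have h2 : j + k - 1 = j - 1 + k := by ring
  have h3 : x (j + k) = x j := hxk j
  have h4 : x (j + 1 + k) = x (j + 1) := hxk (j + 1)
  have h5 : s (j + k) = s j := hsk j
  have h6 : s (j + 1 + k) = s (j + 1) := hsk (j + 1)
  simp only [glue, h1, h2, h3, h4, h5, h6]
  split_ifs <;> first | rfl | simp_all

/-- The action of `Q` on `ℤ × Q` by left multiplication in the second coordinate. -/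
def sndMulLeft (Q : Type*) [Group Q] : Q →* Equiv.Perm (ℤ × Q) where
  toFun q := (Equiv.refl ℤ).prodCongr (Equiv.mulLeft q)
  map_one' := by ext <;> simp
  map_mul' a b := by ext <;> simp [mul_assoc]

/-- The action of the free product of copies of `Q` on `ℤ × Q` in which each copy acts by left
multiplication, conjugated by the corresponding gluing. -/
noncomputable def glueAction (s : ℤ → Q) (hx : ∀ j, x j ≠ x (j + 1)) :
    CoprodI (fun _ : Y => Q) →* Equiv.Perm (ℤ × Q) :=
  CoprodI.lift fun y =>
    (MulAut.conj (Function.Involutive.toPerm _ (glue_involutive (s := s) hx y))).toMonoidHom.comp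
      (sndMulLeft Q)

theorem glueAction_of (hx : ∀ j, x j ≠ x (j + 1)) (y : Y) (q : Q)
    (p : ℤ × Q) : glueAction s hx (CoprodI.of (i := y) q) p =
      glue x s y ((glue x s y p).1, q * (glue x s y p).2) := by
  simp only [glueAction, CoprodI.lift_of]
  rfl

theorem glueAction_add_period (hx : ∀ j, x j ≠ x (j + 1)) {k : ℤ}
    (hxk : Function.Periodic x k) (hsk : Function.Periodic s k) (g : CoprodI fun _ : Y => Q)
    (j : ℤ) (q : Q) :
    glueAction s hx g (j + k, q) =
      ((glueAction s hx g (j, q)).1 + k, (glueAction s hx g (j, q)).2) := by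
  induction g using CoprodI.induction_on generalizing j q with
  | one => simp
  | of y r => simp only [glueAction_of, glue_add_period hxk hsk]
  | mul g h hg hh => simp only [map_mul, Equiv.Perm.mul_apply, hh, hg]

/-- The gluing fixes `(j, 1)`, multiplication moves it to `(j, s j)`, and the gluing takes that to
`(j - 1, 1)`. -/
theorem glueAction_letter (hx : ∀ j, x j ≠ x (j + 1)) (hs : ∀ j, s j ≠ 1) (j : ℤ) :
    glueAction s hx (CoprodI.of (i := x j) (s j)) (j, 1) = (j - 1, 1) := by
  have h1 : glue x s (x j) (j, 1) = (j, 1) := by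
    simp [glue, (hs j).symm, (hx j).symm]
  rw [glueAction_of, h1]
  simp [glue]

theorem isVirtualRetract_zpowers_prod_range [Finite Q] (hx : ∀ j, x j ≠ x (j + 1))
    (hs : ∀ j, s j ≠ 1) {k : ℕ} (hk : 0 < k) (hxk : Function.Periodic x k)
    (hsk : Function.Periodic s k) (w : CoprodI fun _ : Y => Q)
    (hw : w = ((List.range k).map fun j : ℕ =>
      (CoprodI.of (i := x j) (s j) : CoprodI fun _ : Y => Q)).prod) :
    IsVirtualRetract (zpowers w) ∧ ∀ n : ℤ, w ^ n = 1 → n = 0 := by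
  have hper : ∀ (g : CoprodI fun _ : Y => Q) (m j : ℤ) (q : Q),
      glueAction s hx g (j + m * k, q) =
        ((glueAction s hx g (j, q)).1 + m * k, (glueAction s hx g (j, q)).2) :=
    fun g m j q => glueAction_add_period hx (hxk.int_mul m) (hsk.int_mul m) g j q
  -- Acting from the right end of the word, each letter lowers the level by one, from `(k - 1, 1)`
  -- to `(-1, 1)`: a translation by minus one period.
  refine isVirtualRetract_zpowers_of_periodic_action (glueAction s hx)
    (by exact_mod_cast hk) hper (k - 1) 1 w (-1) (by norm_num) ?_
  have key : ∀ n : ℕ, glueAction s hx ((List.range n).map fun j : ℕ =>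
      (CoprodI.of (i := x j) (s j) : CoprodI fun _ : Y => Q)).prod ((n : ℤ) - 1, 1) = (-1, 1) := by
    intro n
    induction n with
    | zero => simp
    | succ n ih =>
      rw [List.range_succ, List.map_append, List.prod_append, map_mul, Equiv.Perm.mul_apply]
      simp only [List.map_cons, List.map_nil, List.prod_singleton]
      rw [show ((n + 1 : ℕ) : ℤ) - 1 = n by push_cast; ring, glueAction_letter hx hs, ih]
  rw [hw, key]
  ext <;> simp
  ring

end Glue

/-- The letter of the free product of copies of `H` given by an index and an element of `H`. -/
def letter (z : Y × H) : CoprodI fun _ : Y => H := CoprodI.of (i := z.1) z.2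

/-- Cyclically reduced words in a free product of copies of `H`: all letters are nontrivial, and
cyclically adjacent letters lie in different factors. -/
def IsCyclicallyReduced (l : List (Y × H)) : Prop :=
  ∀ (i : ℕ) (hi : i < l.length), l[i].2 ≠ 1 ∧
    l[i].1 ≠ (l[(i + 1) % l.length]'(Nat.mod_lt _ (by omega))).1

/-- The word is repeated periodically along `ℤ`; cyclic reducedness makes neighbouring letters lie
in different factors, also across the ends of a period. -/
theorem IsCyclicallyReduced.isVirtualRetract_zpowers [Finite Q] {l : List (Y × Q)}
    (hl : IsCyclicallyReduced l) (hne : l ≠ []) :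
    IsVirtualRetract (zpowers (l.map letter).prod) ∧
      ∀ n : ℤ, (l.map letter).prod ^ n = 1 → n = 0 := by
  have hk : 0 < l.length := List.length_pos_iff.2 hne
  have hk' : (0 : ℤ) < l.length := by exact_mod_cast hk
  have hlt : ∀ j : ℤ, (j % l.length).toNat < l.length := fun j => by
    have := Int.emod_lt_of_pos j hk'
    omega
  let z : ℤ → Y × Q := fun j => l[(j % l.length).toNat]'(hlt j)
  have hz : Function.Periodic z l.length := fun j => by simp [z]
  have hsucc : ∀ j : ℤ, ((j + 1) % l.length).toNat = ((j % l.length).toNat + 1) % l.length := by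
    intro j
    have h1 : ((j % l.length).toNat : ℤ) = j % l.length :=
      Int.toNat_of_nonneg (Int.emod_nonneg _ hk'.ne')
    have h2 : (((j + 1) % l.length).toNat : ℤ) = (j + 1) % l.length :=
      Int.toNat_of_nonneg (Int.emod_nonneg _ hk'.ne')
    zify
    rw [h1, h2]
    simp
  refine isVirtualRetract_zpowers_prod_range (x := fun j => (z j).1) (s := fun j => (z j).2)
    (k := l.length) (fun j => ?_) (fun j => (hl _ (hlt j)).1) hk
    (fun j => congrArg Prod.fst (hz j)) (fun j => congrArg Prod.snd (hz j)) _ ?_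
  · have := (hl _ (hlt j)).2
    simp only [z, hsucc]
    exact this
  · congr 1
    refine List.ext_getElem (by simp) fun i h1 h2 => ?_
    have hi : i < l.length := by simpa using h1
    have h3 : (((i : ℕ) : ℤ) % l.length).toNat = i := by
      rw [Int.emod_eq_of_lt (by positivity) (by exact_mod_cast hi)]
      simp
    have h4 : z i = l[i] := by simp only [z, h3]
    simp only [List.getElem_map, List.getElem_range, h4]
    rfl

theorem exists_prod_letter (n : CoprodI fun _ : Y => H) :
    ∃ l : List (Y × H), n = (l.map letter).prod := by
  induction n using CoprodI.induction_on with
  | one => exact ⟨[], rfl⟩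
  | of y h => exact ⟨[(y, h)], by simp [letter]⟩
  | mul a b ha hb =>
    obtain ⟨l, rfl⟩ := ha
    obtain ⟨l', rfl⟩ := hb
    exact ⟨l ++ l', by simp⟩

/-- Take a shortest word among all conjugates. A trivial letter could be dropped, and two cyclically
adjacent letters from one factor could be merged after a rotation, which is a conjugation. A single
letter is cyclically adjacent to itself, hence the length condition. -/
theorem exists_conj_isCyclicallyReduced (n : CoprodI fun _ : Y => H) :
    ∃ (c : CoprodI fun _ : Y => H) (l : List (Y × H)), c * n * c⁻¹ = (l.map letter).prod ∧
      (2 ≤ l.length → IsCyclicallyReduced l) := by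
  classical
  have hex : ∃ k : ℕ, ∃ (c : CoprodI fun _ : Y => H) (l : List (Y × H)),
      c * n * c⁻¹ = (l.map letter).prod ∧ l.length = k := by
    obtain ⟨l, hl⟩ := exists_prod_letter n
    exact ⟨_, 1, l, by simpa using hl, rfl⟩
  obtain ⟨c, l, hc, hlen⟩ := Nat.find_spec hex
  have hmin : ∀ (d : CoprodI fun _ : Y => H) (l' : List (Y × H)),
      d * n * d⁻¹ = (l'.map letter).prod → l.length ≤ l'.length := by
    intro d l' h
    rw [hlen]
    exact Nat.find_min' hex ⟨d, l', h, rfl⟩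
  refine ⟨c, l, hc, fun h2 i hi => ?_⟩
  obtain ⟨d, hd⟩ : ∃ d : CoprodI fun _ : Y => H,
      d * n * d⁻¹ = ((l.rotate i).map letter).prod := by
    refine ⟨((l.take i).map letter).prod⁻¹ * c, ?_⟩
    rw [List.rotate_eq_drop_append_take hi.le, List.map_append, List.prod_append]
    have h1 : (l.map letter).prod = ((l.take i).map letter).prod * ((l.drop i).map letter).prod := by
      rw [← List.prod_append, ← List.map_append, List.take_append_drop]
    calc _ = ((l.take i).map letter).prod⁻¹ * (c * n * c⁻¹) * ((l.take i).map letter).prod := by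
          group
      _ = _ := by rw [hc, h1]; group
  have ha : l[i] = (l.rotate i)[0]'(by simp; omega) := by
    rw [List.getElem_rotate]
    simp [Nat.mod_eq_of_lt hi]
  have hb : l[(i + 1) % l.length]'(Nat.mod_lt _ (by omega)) =
      (l.rotate i)[1]'(by simp; omega) := by
    rw [List.getElem_rotate]
    simp [add_comm]
  rw [ha, hb]
  have key : ∀ (l' : List (Y × H)) (h : 2 ≤ l'.length), l'.length = l.length →
      d * n * d⁻¹ = (l'.map letter).prod → l'[0].2 ≠ 1 ∧ l'[0].1 ≠ l'[1].1 := by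
    intro l' h2' h hd
    match l', h2', h with
    | (y, a) :: (y', b) :: r, _, h =>
      simp only [List.getElem_cons_zero, List.getElem_cons_succ]
      constructor
      · rintro rfl
        have := hmin d ((y', b) :: r) (by rw [hd]; simp [letter])
        simp at this h
        omega
      · rintro rfl
        have := hmin d ((y, a * b) :: r) (by rw [hd]; simp [letter, mul_assoc])
        simp at this h
        omega
  exact key _ (by simpa using h2) (by simp) hd

/-- The homomorphism of free products of copies of a group induced by a map of index sets and a
homomorphism. -/
def relabel (θ : Y → Y') (π : H →* Q) :
    CoprodI (fun _ : Y => H) →* CoprodI (fun _ : Y' => Q) :=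
  CoprodI.lift fun y => (CoprodI.of (M := fun _ : Y' => Q) (i := θ y)).comp π

@[simp] theorem relabel_of (θ : Y → Y') (π : H →* Q) (y : Y) (h : H) :
    relabel θ π (CoprodI.of (M := fun _ : Y => H) (i := y) h) =
      CoprodI.of (M := fun _ : Y' => Q) (i := θ y) (π h) := by
  simp [relabel]

theorem relabel_comp (θ : Y → Y') (π : H →* Q) (θ' : Y' → Y'') (π' : Q →* R) :
    (relabel θ' π').comp (relabel θ π) = relabel (θ' ∘ θ) (π'.comp π) :=
  CoprodI.ext_hom _ _ fun y => by ext h; simp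

theorem relabel_id : relabel (id : Y → Y) (MonoidHom.id H) = MonoidHom.id _ :=
  CoprodI.ext_hom _ _ fun y => by ext h; simp

/-- The action of a group on a free product of copies of `H` by permuting the factors. -/
def permuteFactors (A Y H : Type*) [Group A] [MulAction A Y] [Group H] :
    A →* MulAut (CoprodI fun _ : Y => H) where
  toFun a := MonoidHom.toMulEquiv (relabel (a • ·) (MonoidHom.id H))
    (relabel (a⁻¹ • ·) (MonoidHom.id H))
    (by
      rw [relabel_comp, ← relabel_id]
      congr 1
      ext y; simp)
    (by
      rw [relabel_comp, ← relabel_id]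
      congr 1
      ext y; simp)
  map_one' := by
    refine MulEquiv.toMonoidHom_injective (CoprodI.ext_hom _ _ fun y => ?_)
    ext h
    simp
  map_mul' a b := by
    refine MulEquiv.toMonoidHom_injective (CoprodI.ext_hom _ _ fun y => ?_)
    ext h
    simp [mul_smul]

theorem permuteFactors_apply {A : Type*} [Group A] [MulAction A Y] (a : A)
    (n : CoprodI fun _ : Y => H) :
    permuteFactors A Y H a n = relabel (a • ·) (MonoidHom.id H) n := rfl

end FreeProduct


/-! ### (VRC) for the semidirect product with a free product of copies of `H`. -/

section Semidirect

open SemidirectProduct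

variable {A H : Type*} [Group A] [Group H]

/-- In a group with (VRC), the fixed subgroup of an endomorphism is separable. -/
theorem HasVRC.exists_normal_notMem_sup (hA : HasVRC A) (r : A →* A) {x : A}
    (hx : x ∉ r.eqLocus (MonoidHom.id A)) :
    ∃ C : Subgroup A, C.FiniteIndex ∧ C.Normal ∧ x ∉ r.eqLocus (MonoidHom.id A) ⊔ C := by
  have hx' : x⁻¹ * r x ≠ 1 := fun h => hx (inv_mul_eq_one.1 h).symm
  obtain ⟨C, hC, hCn, hxC⟩ := (hA.zpowers _).exists_finiteIndex_notMem hx'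
  -- The expression `a⁻¹ * r a` is unchanged when `a` is multiplied on the left by a fixed element,
  -- and for `a` in this intersection it lies in `C`.
  refine ⟨C ⊓ C.comap r, inferInstance, inferInstance, fun hmem => hxC ?_⟩
  obtain ⟨b, hb, c, ⟨hc, hc'⟩, rfl⟩ := mem_sup_of_normal_right.1 hmem
  have hb' : r b = b := hb
  have : (b * c)⁻¹ * r (b * c) = c⁻¹ * r c := by
    rw [map_mul, hb']; group
  rw [this]
  exact C.mul_mem (C.inv_mem hc) hc'

/-- This keeps adjacent letters of a word in different factors after passing to a finite-index
quotient; finitely many pairs are handled by intersecting. -/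
theorem HasVRC.exists_normal_quotient_injOn (hA : HasVRC A) (r : A →* A) {ι : Type*} [Finite ι]
    (u v : ι → A ⧸ r.eqLocus (MonoidHom.id A)) (huv : ∀ i, u i ≠ v i) :
    ∃ C : Subgroup A, C.FiniteIndex ∧ C.Normal ∧ ∀ i,
      quotientMapOfLE (le_sup_left : _ ≤ r.eqLocus (MonoidHom.id A) ⊔ C) (u i) ≠
        quotientMapOfLE (le_sup_left : _ ≤ r.eqLocus (MonoidHom.id A) ⊔ C) (v i) := by
  have h : ∀ i, (u i).out⁻¹ * (v i).out ∉ r.eqLocus (MonoidHom.id A) := by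
    intro i hi
    apply huv i
    rw [← QuotientGroup.out_eq' (u i), ← QuotientGroup.out_eq' (v i), QuotientGroup.eq]
    exact hi
  choose C hC hCn hxC using fun i => hA.exists_normal_notMem_sup r (h i)
  refine ⟨⨅ i, C i, finiteIndex_iInf hC, normal_iInf_normal hCn, fun i hi => ?_⟩
  rw [← QuotientGroup.out_eq' (u i), ← QuotientGroup.out_eq' (v i)] at hi
  have h1 := QuotientGroup.eq.1 hi
  exact hxC i (sup_le_sup_left (iInf_le C i) _ h1)

theorem HasVRC.exists_normal_notMem (hH : HasVRC H) {ι : Type*} [Finite ι]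
    (s : ι → H) (hs : ∀ i, s i ≠ 1) :
    ∃ D : Subgroup H, D.FiniteIndex ∧ D.Normal ∧ ∀ i, s i ∉ D := by
  choose D hD hDn hsD using fun i => (hH.zpowers (s i)).exists_finiteIndex_notMem (hs i)
  exact ⟨⨅ i, D i, finiteIndex_iInf hD, normal_iInf_normal hDn,
    fun i hi => hsD i (mem_iInf.1 hi i)⟩

/-- (VRC) for the semidirect product of a free product of copies of `H`, indexed by the cosets of
the fixed subgroup of an endomorphism of `A`, with `A` permuting the factors. -/
theorem HasVRC.semidirectProduct (hA : HasVRC A) (hH : HasVRC H) (r : A →* A) :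
    HasVRC ((CoprodI fun _ : A ⧸ r.eqLocus (MonoidHom.id A) => H) ⋊[permuteFactors A _ H] A) := by
  refine HasVRC.of_ker rightHom hA fun t ht => ?_
  rw [← range_inl_eq_ker_rightHom] at ht
  obtain ⟨n, rfl⟩ := ht
  obtain ⟨c, l, hc, hl⟩ := exists_conj_isCyclicallyReduced n
  refine isVirtualRetract_conj (inl c) ?_
  rw [← map_inv, ← map_mul, ← map_mul, hc]
  clear hc
  by_cases h2 : 2 ≤ l.length
  · replace hl := hl h2
    obtain ⟨C, hC, hCn, hCs⟩ := hA.exists_normal_quotient_injOn r (ι := Fin l.length)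
      (fun i => l[i].1) (fun i => (l[(i.1 + 1) % l.length]'(Nat.mod_lt _ (by omega))).1)
      (fun i => (hl i.1 i.2).2)
    obtain ⟨D, hD, hDn, hDs⟩ := hH.exists_normal_notMem (ι := Fin l.length)
      (fun i => l[i].2) (fun i => (hl i.1 i.2).1)
    let θ : A ⧸ r.eqLocus (MonoidHom.id A) → A ⧸ (r.eqLocus (MonoidHom.id A) ⊔ C) :=
      quotientMapOfLE le_sup_left
    have hθ : ∀ c ∈ C, ∀ x, θ (c • x) = θ x := by
      intro c hc x
      obtain ⟨a, rfl⟩ := QuotientGroup.mk_surjective x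
      change (QuotientGroup.mk (c * a) : A ⧸ (r.eqLocus (MonoidHom.id A) ⊔ C)) = QuotientGroup.mk a
      rw [QuotientGroup.eq]
      refine mem_sup_right ?_
      have := hCn.conj_mem _ (C.inv_mem hc) a⁻¹
      simpa [mul_assoc] using this
    let K : Subgroup ((CoprodI fun _ : A ⧸ r.eqLocus (MonoidHom.id A) => H)
      ⋊[permuteFactors A _ H] A) := C.comap rightHom
    -- `C` acts trivially on the coarser cosets, so on `K` forgetting the `A`-coordinate and
    -- relabelling is multiplicative.
    let Φ : K →* CoprodI fun _ : A ⧸ (r.eqLocus (MonoidHom.id A) ⊔ C) => H ⧸ D :=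
      MonoidHom.mk' (fun t => relabel θ (QuotientGroup.mk' D) t.1.left) (by
        rintro ⟨s, hs⟩ ⟨t, ht⟩
        simp only [MulMemClass.mk_mul_mk, mul_left, map_mul]
        congr 1
        rw [permuteFactors_apply, ← MonoidHom.comp_apply, relabel_comp]
        congr 2
        funext x
        exact hθ _ hs x)
    have hw : ∀ l : List ((A ⧸ r.eqLocus (MonoidHom.id A)) × H),
        relabel θ (QuotientGroup.mk' D) (l.map letter).prod =
        ((l.map fun z => (θ z.1, (z.2 : H ⧸ D))).map letter).prod := by
      intro l
      rw [map_list_prod, List.map_map, List.map_map]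
      congr 2
    have hred : IsCyclicallyReduced (l.map fun z => (θ z.1, (z.2 : H ⧸ D))) := by
      intro i hi
      have hi' : i < l.length := by simpa using hi
      simp only [List.getElem_map, List.length_map]
      refine ⟨fun h => hDs ⟨i, hi'⟩ ((QuotientGroup.eq_one_iff _).1 h), hCs ⟨i, hi'⟩⟩
    have : Finite (H ⧸ D) := finite_quotient_of_finiteIndex
    obtain ⟨h3, h4⟩ := hred.isVirtualRetract_zpowers (by
      intro h
      have := congrArg List.length h
      simp at this
      simp [this] at h2)
    rw [← hw] at h3 h4
    have hwK : inl (l.map letter).prod ∈ K := by simp [K]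
    refine isVirtualRetract_zpowers_of_hom K Φ ⟨_, hwK⟩ (fun n hn => ?_) h3
    rw [h4 n hn, zpow_zero]
  · match l, h2 with
    | [], _ =>
      simp only [List.map_nil, List.prod_nil, map_one]
      exact isVirtualRetract_zpowers_of_isOfFinOrder IsOfFinOrder.one (by simp)
    | [z], _ =>
      -- Folding all factors onto one copy of `H` is invariant under permuting them, so it extends
      -- by the trivial map on `A`; it is injective on each factor.
      let q : ((CoprodI fun _ : A ⧸ r.eqLocus (MonoidHom.id A) => H)
          ⋊[permuteFactors A _ H] A) →* H :=
        SemidirectProduct.lift (CoprodI.lift fun _ => MonoidHom.id H) 1 (by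
          intro a
          refine CoprodI.ext_hom _ _ fun y => ?_
          ext h
          simp [permuteFactors_apply])
      have hq : q (inl (letter z)) = z.2 := by simp [q, letter]
      simp only [List.map_cons, List.map_nil, List.prod_singleton]
      refine isVirtualRetract_zpowers_of_map q _ (fun n hn => ?_) (hH.zpowers _)
      rw [hq] at hn
      rw [← map_zpow, letter, ← map_zpow, hn, map_one, map_one]
    | _ :: _ :: _, h2 => simp at h2

end Semidirect


/-! ### Graph products: retractions onto vertex sets, and adding one vertex. -/

namespace GraphProduct

variable {V : Type*} (Γ : SimpleGraph V) (𝔊 : V → Type*) [∀ v, Group (𝔊 v)]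
variable {P : Type*} [Group P]

/-- The homomorphism from a vertex group to the graph product. -/
def of (v : V) : 𝔊 v →* GraphProduct Γ 𝔊 :=
  (QuotientGroup.mk' (normalClosure (graphProductRelators Γ 𝔊))).comp CoprodI.of

variable {Γ 𝔊}

theorem commute_of {u v : V} (h : Γ.Adj u v) (a : 𝔊 u) (b : 𝔊 v) :
    Commute (of Γ 𝔊 u a) (of Γ 𝔊 v b) := by
  have h1 : QuotientGroup.mk' (normalClosure (graphProductRelators Γ 𝔊))
      (CoprodI.of a * CoprodI.of b * (CoprodI.of a)⁻¹ * (CoprodI.of b)⁻¹) = 1 :=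
    (QuotientGroup.eq_one_iff _).2 (subset_normalClosure ⟨u, v, h, a, b, rfl⟩)
  rw [map_mul, map_mul, map_mul, map_inv, map_inv, mul_inv_eq_one, mul_inv_eq_iff_eq_mul] at h1
  exact h1

/-- The universal property of the graph product. -/
def lift (f : ∀ v, 𝔊 v →* P)
    (hf : ∀ u v, Γ.Adj u v → ∀ (a : 𝔊 u) (b : 𝔊 v), Commute (f u a) (f v b)) :
    GraphProduct Γ 𝔊 →* P :=
  QuotientGroup.lift (normalClosure (graphProductRelators Γ 𝔊)) (CoprodI.lift f) (by
    intro x hx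
    refine MonoidHom.mem_ker.1 (normalClosure_le_normal (N := (CoprodI.lift f).ker) ?_ hx)
    rintro _ ⟨u, v, huv, a, b, rfl⟩
    have h := (hf u v huv a b).eq
    simp only [SetLike.mem_coe, MonoidHom.mem_ker, map_mul, map_inv, CoprodI.lift_of]
    rw [mul_inv_eq_one, mul_inv_eq_iff_eq_mul, h])

@[simp] theorem lift_of (f : ∀ v, 𝔊 v →* P)
    (hf : ∀ u v, Γ.Adj u v → ∀ (a : 𝔊 u) (b : 𝔊 v), Commute (f u a) (f v b)) (v : V) (a : 𝔊 v) :
    lift f hf (of Γ 𝔊 v a) = f v a :=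
  CoprodI.lift_of f a

theorem hom_ext {f g : GraphProduct Γ 𝔊 →* P}
    (h : ∀ v a, f (of Γ 𝔊 v a) = g (of Γ 𝔊 v a)) : f = g :=
  QuotientGroup.monoidHom_ext (normalClosure (graphProductRelators Γ 𝔊))
    (CoprodI.ext_hom _ _ fun v => MonoidHom.ext fun a => h v a)

theorem induction_on {motive : GraphProduct Γ 𝔊 → Prop} (g : GraphProduct Γ 𝔊)
    (one : motive 1) (of : ∀ v a, motive (of Γ 𝔊 v a))
    (mul : ∀ x y, motive x → motive y → motive (x * y)) : motive g := by
  obtain ⟨w, rfl⟩ := QuotientGroup.mk'_surjective (normalClosure (graphProductRelators Γ 𝔊)) g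
  induction w using CoprodI.induction_on with
  | one => exact one
  | of v a => exact of v a
  | mul x y hx hy => exact mul _ _ hx hy

variable (Γ 𝔊)

open Classical in
/-- The endomorphism of the graph product killing the vertex groups outside a set of vertices. -/
noncomputable def restrict (S : Set V) : GraphProduct Γ 𝔊 →* GraphProduct Γ 𝔊 :=
  lift (fun v => if v ∈ S then of Γ 𝔊 v else 1) (by
    intro u v huv a b
    split_ifs <;> simp [commute_of huv])

variable {Γ 𝔊}

theorem restrict_of_mem {S : Set V} {v : V} (hv : v ∈ S) (a : 𝔊 v) :
    restrict Γ 𝔊 S (of Γ 𝔊 v a) = of Γ 𝔊 v a := by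
  simp [restrict, hv]

theorem restrict_of_notMem {S : Set V} {v : V} (hv : v ∉ S) (a : 𝔊 v) :
    restrict Γ 𝔊 S (of Γ 𝔊 v a) = 1 := by
  simp [restrict, hv]

theorem restrict_restrict_of_subset {S S' : Set V} (h : S ⊆ S') (g : GraphProduct Γ 𝔊) :
    restrict Γ 𝔊 S' (restrict Γ 𝔊 S g) = restrict Γ 𝔊 S g := by
  suffices H : (restrict Γ 𝔊 S').comp (restrict Γ 𝔊 S) = restrict Γ 𝔊 S from
    DFunLike.congr_fun H g
  refine hom_ext fun v a => ?_
  by_cases hv : v ∈ S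
  · simp [restrict_of_mem hv, restrict_of_mem (h hv)]
  · simp [restrict_of_notMem hv]

theorem exists_restrict_eq_self (g : GraphProduct Γ 𝔊) :
    ∃ S : Finset V, restrict Γ 𝔊 S g = g := by
  classical
  induction g using induction_on with
  | one => exact ⟨∅, map_one _⟩
  | of v a => exact ⟨{v}, restrict_of_mem (by simp) a⟩
  | mul x y hx hy =>
    obtain ⟨S, hS⟩ := hx
    obtain ⟨T, hT⟩ := hy
    refine ⟨S ∪ T, ?_⟩
    have h1 : restrict Γ 𝔊 ((S ∪ T : Finset V) : Set V) x = x := by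
      rw [← hS, restrict_restrict_of_subset (by simp)]
    have h2 : restrict Γ 𝔊 ((S ∪ T : Finset V) : Set V) y = y := by
      rw [← hT, restrict_restrict_of_subset (by simp)]
    rw [map_mul, h1, h2]

section Vertex

variable (Γ 𝔊) (S : Set V) (v : V)

/-- The endomorphism of the subgroup of the graph product over `S` killing the vertex groups at the
vertices not adjacent to `v`. -/
noncomputable def linkRestrict : (restrict Γ 𝔊 S).range →* (restrict Γ 𝔊 S).range :=
  (restrict Γ 𝔊 S).rangeRestrict.comp
    ((restrict Γ 𝔊 {u | Γ.Adj u v}).comp (restrict Γ 𝔊 S).range.subtype)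

/-- The subgroup of the graph product over the vertices of `S` adjacent to `v`. -/
noncomputable abbrev link : Subgroup (restrict Γ 𝔊 S).range :=
  (linkRestrict Γ 𝔊 S v).eqLocus (MonoidHom.id _)

/-- The semidirect product describing the graph product over `insert v S`. -/
abbrev VertexExtension : Type _ :=
  (CoprodI fun _ : (restrict Γ 𝔊 S).range ⧸ link Γ 𝔊 S v => 𝔊 v)
    ⋊[permuteFactors (restrict Γ 𝔊 S).range _ (𝔊 v)] (restrict Γ 𝔊 S).range

variable {Γ 𝔊 S v}

/-- A fixed element equals its image under the two restrictions, and the only generators surviving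
both belong to neighbours of `v`. -/
theorem commute_of_mem_link {a : (restrict Γ 𝔊 S).range} (ha : a ∈ link Γ 𝔊 S v) (h : 𝔊 v) :
    Commute (a : GraphProduct Γ 𝔊) (of Γ 𝔊 v h) := by
  have ha' : restrict Γ 𝔊 S (restrict Γ 𝔊 {u | Γ.Adj u v} a) = a := congrArg Subtype.val ha
  rw [← ha']
  generalize (a : GraphProduct Γ 𝔊) = g
  induction g using induction_on with
  | one => simp
  | of u b =>
    by_cases hu : Γ.Adj u v
    · rw [restrict_of_mem (by exact hu)]
      by_cases huS : u ∈ S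
      · rw [restrict_of_mem huS]
        exact commute_of hu b h
      · simp [restrict_of_notMem huS]
    · rw [restrict_of_notMem (by exact hu)]
      simp
  | mul x y hx hy => simpa using hx.mul_left hy

theorem rangeRestrict_of_mem_link {u : V} (hu : Γ.Adj u v) (b : 𝔊 u) :
    (restrict Γ 𝔊 S).rangeRestrict (of Γ 𝔊 u b) ∈ link Γ 𝔊 S v := by
  apply Subtype.ext
  change restrict Γ 𝔊 S (restrict Γ 𝔊 _ (restrict Γ 𝔊 S (of Γ 𝔊 u b))) =
    restrict Γ 𝔊 S (of Γ 𝔊 u b)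
  by_cases huS : u ∈ S
  · rw [restrict_of_mem huS, restrict_of_mem (by exact hu), restrict_of_mem huS]
  · simp [restrict_of_notMem huS]

variable (Γ 𝔊 S v)

/-- The embedding of the vertex group at `v` as the factor of the vertex extension indexed by the
trivial coset. -/
noncomputable def vertexInl : 𝔊 v →* VertexExtension Γ 𝔊 S v :=
  SemidirectProduct.inl.comp (CoprodI.of
    (M := fun _ : (restrict Γ 𝔊 S).range ⧸ link Γ 𝔊 S v => 𝔊 v) (i := (1 : (restrict Γ 𝔊 S).range)))

/-- The map of the graph product to the subgroup over `S`, viewed in the vertex extension. -/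
noncomputable def vertexInr : GraphProduct Γ 𝔊 →* VertexExtension Γ 𝔊 S v :=
  SemidirectProduct.inr.comp (restrict Γ 𝔊 S).rangeRestrict

variable {Γ 𝔊 S v}

/-- The image of `b` lies in the link, so it stabilizes the trivial coset and fixes that factor
pointwise. -/
theorem commute_vertexInr_vertexInl {u : V} (hu : Γ.Adj u v) (b : 𝔊 u) (h : 𝔊 v) :
    Commute (vertexInr Γ 𝔊 S v (of Γ 𝔊 u b)) (vertexInl Γ 𝔊 S v h) := by
  have hmem := rangeRestrict_of_mem_link (S := S) hu b
  simp only [vertexInr, vertexInl, MonoidHom.comp_apply]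
  rw [Commute, SemiconjBy, ← mul_inv_eq_iff_eq_mul, ← map_inv, ← SemidirectProduct.inl_aut,
    permuteFactors_apply, relabel_of]
  have h1 : (restrict Γ 𝔊 S).rangeRestrict (of Γ 𝔊 u b) •
      (QuotientGroup.mk 1 : (restrict Γ 𝔊 S).range ⧸ link Γ 𝔊 S v) = QuotientGroup.mk 1 := by
    change (QuotientGroup.mk (_ * 1) : (restrict Γ 𝔊 S).range ⧸ link Γ 𝔊 S v) = _
    rw [QuotientGroup.eq]
    simpa using hmem
  rw [h1]
  rfl

variable (Γ 𝔊 S v)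

open Classical in
/-- The map to the vertex extension on the vertex groups. -/
noncomputable def vertexMap (u : V) : 𝔊 u →* VertexExtension Γ 𝔊 S v :=
  if h : u = v then (vertexInl Γ 𝔊 S v).comp (h ▸ MonoidHom.id (𝔊 u))
  else (vertexInr Γ 𝔊 S v).comp (of Γ 𝔊 u)

variable {Γ 𝔊 S v}

theorem vertexMap_self : vertexMap Γ 𝔊 S v v = vertexInl Γ 𝔊 S v := by
  simp only [vertexMap, dif_pos]
  rfl

theorem vertexMap_of_ne {u : V} (h : u ≠ v) :
    vertexMap Γ 𝔊 S v u = (vertexInr Γ 𝔊 S v).comp (of Γ 𝔊 u) := by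
  simp only [vertexMap, dif_neg h]

variable (Γ 𝔊 S v)

/-- The homomorphism from the graph product to the vertex extension. -/
noncomputable def toVertexExtension : GraphProduct Γ 𝔊 →* VertexExtension Γ 𝔊 S v :=
  lift (vertexMap Γ 𝔊 S v) (by
    intro u w huw a b
    by_cases hu : u = v
    · subst hu
      rw [vertexMap_self, vertexMap_of_ne huw.ne']
      exact (commute_vertexInr_vertexInl huw.symm b a).symm
    · rw [vertexMap_of_ne hu]
      by_cases hw : w = v
      · subst hw
        rw [vertexMap_self]
        exact commute_vertexInr_vertexInl huw a b
      · rw [vertexMap_of_ne hw]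
        exact (commute_of huw a b).map (vertexInr Γ 𝔊 S v))

/-- The homomorphism from the vertex extension to the graph product. -/
noncomputable def ofVertexExtension : VertexExtension Γ 𝔊 S v →* GraphProduct Γ 𝔊 :=
  SemidirectProduct.lift
    (CoprodI.lift fun x : (restrict Γ 𝔊 S).range ⧸ link Γ 𝔊 S v =>
      (MulAut.conj (x.out : GraphProduct Γ 𝔊)).toMonoidHom.comp (of Γ 𝔊 v))
    (restrict Γ 𝔊 S).range.subtype (by
      intro a
      refine CoprodI.ext_hom _ _ fun x => MonoidHom.ext fun h => ?_
      -- The representatives `(a • x).out` and `a * x.out` differ by a link element, which commutes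
      -- with `𝔊 v`, so both conjugate `𝔊 v` in the same way.
      have hmem : (a * x.out)⁻¹ * (a • x).out ∈ link Γ 𝔊 S v := by
        rw [← QuotientGroup.eq, QuotientGroup.out_eq']
        conv_rhs => rw [← QuotientGroup.out_eq' x]
        rfl
      obtain ⟨b, hb⟩ : ∃ b, b = (a * x.out)⁻¹ * (a • x).out := ⟨_, rfl⟩
      rw [← hb] at hmem
      have hout : (a • x).out = a * x.out * b := by rw [hb, mul_inv_cancel_left]
      have hcomm := (commute_of_mem_link hmem h).eq
      simp only [MonoidHom.comp_apply, MulEquiv.coe_toMonoidHom, permuteFactors_apply, relabel_of,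
        CoprodI.lift_of, MonoidHom.id_apply, MulAut.conj_apply, hout, Subgroup.coe_mul,
        Subgroup.coe_subtype, mul_inv_rev]
      rw [mul_assoc _ (b : GraphProduct Γ 𝔊), hcomm]
      group)

variable {Γ 𝔊 S v}

/-- This composite alone suffices: it makes `toVertexExtension` injective on the subgroup over
`insert v S`, and (VRC) passes to subgroups. -/
theorem ofVertexExtension_toVertexExtension (hv : v ∉ S) (g : GraphProduct Γ 𝔊) :
    ofVertexExtension Γ 𝔊 S v (toVertexExtension Γ 𝔊 S v g) =
      restrict Γ 𝔊 (insert v S) g := by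
  suffices H : (ofVertexExtension Γ 𝔊 S v).comp (toVertexExtension Γ 𝔊 S v) =
      restrict Γ 𝔊 (insert v S) from DFunLike.congr_fun H g
  refine hom_ext fun u a => ?_
  simp only [MonoidHom.comp_apply, toVertexExtension, lift_of]
  by_cases hu : u = v
  · subst hu
    rw [vertexMap_self, restrict_of_mem (Set.mem_insert u S)]
    simp only [vertexInl, ofVertexExtension, MonoidHom.comp_apply, SemidirectProduct.lift_inl,
      CoprodI.lift_of, MulEquiv.coe_toMonoidHom, MulAut.conj_apply]
    -- The chosen representative of the trivial coset need not be `1`, but it lies in the link and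
    -- so commutes with `𝔊 u`.
    have hmem : (QuotientGroup.mk 1 : (restrict Γ 𝔊 S).range ⧸ link Γ 𝔊 S u).out ∈
        link Γ 𝔊 S u := by
      have := QuotientGroup.eq.1 (QuotientGroup.out_eq'
        (QuotientGroup.mk 1 : (restrict Γ 𝔊 S).range ⧸ link Γ 𝔊 S u)).symm
      simpa using this
    rw [(commute_of_mem_link hmem a).eq, mul_inv_cancel_right]
  · rw [vertexMap_of_ne hu]
    simp only [vertexInr, ofVertexExtension, MonoidHom.comp_apply, SemidirectProduct.lift_inr]
    change restrict Γ 𝔊 S (of Γ 𝔊 u a) = _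
    by_cases huS : u ∈ S
    · rw [restrict_of_mem huS, restrict_of_mem (Set.mem_insert_of_mem v huS)]
    · rw [restrict_of_notMem huS, restrict_of_notMem (by simp [hu, huS])]

end Vertex

theorem hasVRC_range_restrict (h𝔊 : ∀ v, HasVRC (𝔊 v)) (S : Finset V) :
    HasVRC (restrict Γ 𝔊 (S : Set V)).range := by
  classical
  induction S using Finset.induction_on with
  | empty =>
    have h1 : restrict Γ 𝔊 ((∅ : Finset V) : Set V) = 1 :=
      hom_ext fun v a => restrict_of_notMem (by simp) a
    have h2 : Finite (restrict Γ 𝔊 ((∅ : Finset V) : Set V)).range := by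
      rw [h1, MonoidHom.range_one]
      infer_instance
    exact fun H _ => isVirtualRetract_of_finiteIndex H
  | insert v S hv ih =>
    refine HasVRC.of_injective ((toVertexExtension Γ 𝔊 (S : Set V) v).comp
      (restrict Γ 𝔊 ((insert v S : Finset V) : Set V)).range.subtype) ?_
      (ih.semidirectProduct (h𝔊 v) (linkRestrict Γ 𝔊 (S : Set V) v))
    have hinv : ∀ x : (restrict Γ 𝔊 ((insert v S : Finset V) : Set V)).range,
        ofVertexExtension Γ 𝔊 (S : Set V) v (toVertexExtension Γ 𝔊 (S : Set V) v x) = x := by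
      rintro ⟨_, g, rfl⟩
      rw [ofVertexExtension_toVertexExtension (by simpa using hv)]
      simp only [Finset.coe_insert]
      exact restrict_restrict_of_subset le_rfl g
    intro x y hxy
    apply Subtype.ext
    rw [← hinv x, ← hinv y]
    exact congrArg _ hxy

end GraphProduct

end VirtualRetraction

theorem mainTheorem6 {V : Type*} (Γ : SimpleGraph V) (𝔊 : V → Type*) [∀ v, Group (𝔊 v)]
    (h𝔊 : ∀ v, VirtualRetraction.HasVRC (𝔊 v)) :
    VirtualRetraction.HasVRC (VirtualRetraction.GraphProduct Γ 𝔊) := by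
  refine VirtualRetraction.hasVRC_of_zpowers fun g => ?_
  obtain ⟨S, hS⟩ := VirtualRetraction.GraphProduct.exists_restrict_eq_self g
  -- The restriction to `S` fixes `g`, so it is injective on `⟨g⟩`.
  refine VirtualRetraction.isVirtualRetract_zpowers_of_map
    (VirtualRetraction.GraphProduct.restrict Γ 𝔊 (S : Set V)).rangeRestrict g (fun n hn => ?_)
    ((VirtualRetraction.GraphProduct.hasVRC_range_restrict h𝔊 S).zpowers _)
  have := congrArg Subtype.val hn
  simpa [hS] using this
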